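/- Let $\varrho$ be the substitution of constant length $5$ on the alphabet $\mathcal A=\{0,1,2,3,5,6\}$ given by $$0\mapsto 30261,\quad 1\mapsto 31603,\quad 2\mapsto 52603,\quad 3\mapsto 53025,\quad 5\mapsto 15261,\quad 6\mapsto 16025,$$ let $\mathbb X_\varrho\subset\mathcal A^{\mathbb Z}$ be its subshift (all bi-infinite sequences each of whose finite words occurs in some $\varrho^k(a)$, $a\in\mathcal A$, $k\ge 1$), let $(\sigma x)_n=x_{n+1}$ be the shift, and let $\tau$ be the permutation $(0\,3)(1\,6)(2\,5)$ of $\mathcal A$. Then: 1. $\varrho$ is primitive and aperiodic, and every power $\varrho^n$, $n\ge 1$, is strongly injective: there are no two left-infinite fixed points of $\varrho^n$ that agree everywhere except at their $0$th (rightmost) entry, and no two right-infinite fixed points of $\varrho^n$ that agree everywhere except at their $0$th (leftmost) entry. 2. $\Phi(x)_n=\tau(x_{-n})$ defines a self-homeomorphism $\Phi$ of $\mathbb X_\varrho$ with $\Phi\circ\sigma^n=\sigma^{-n}\circ\Phi$ for all $n\in\mathbb Z$; that is, $\Phi=(\tau,\text{mirror})$ is an extended symmetry of radius $0$ with linear part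 $-1$. 3. There is exactly one tiling factor map $\pi\colon\mathbb X_\varrho\to\mathbb Z_5$ (into the $5$-adic integers), i.e. map such that for all $x\in\mathbb X_\varrho$ and $n\ge 0$ one has $x=\sigma^{j}\varrho^n(y)$ for some $y\in\mathbb X_\varrho$, where $0\le j<5^n$ and $j\equiv\pi(x)\pmod{5^n}$. It exhibits the rotation by $1$ on $\mathbb Z_5$ as the maximal equicontinuous factor of $(\mathbb X_\varrho,\sigma)$. There is exactly one $\kappa=\kappa(\Phi)\in\mathbb Z_5$ for which some automorphism $\zeta$ of the topological group $\mathbb Z_5$ satisfies $\pi(\Phi(x))=\kappa+\zeta(\pi(x))$ for all $x\in\mathbb X_\varrho$; and $\kappa(\Phi)\ne 0$. Moreover $\kappa(\Phi)\notin\mathbb Z$ (equivalently, $\kappa(\sigma^m\circ\Phi)\neq 0$ for all $m\in\mathbb Z$). 4. $\Phi$ is not supertile-shuffling: there are no permutation $\tau'$ of $\mathcal A$, sign $A\in\{1,-1\}$ and $N\in\mathbb N$ such that $\Phi\circ\sigma^n=\sigma^{An}\circ\Phi$ and $\Phi(x)_n=\tau'(x_{A n})$ for all $x\in\mathbb X_\varrho$,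 $n\in\mathbb Z$, and such that for all $n\ge N$, $a\in\mathcal A$ and $0\le i<5^n$ one has $\varrho^n(\tau'(a))_i=\tau'(\varrho^n(a)_{A\odot i})$, where $1\odot i=i$ and $(-1)\odot i=5^n-1-i$. -/

import Mathlib

open SymbolicDynamics.FullShift

/-- A constant-length substitution of length `L` on the alphabet `α`: the letter `a` is replaced by
the word `θ a 0, θ a 1, …, θ a (L - 1)`. -/
abbrev Substitution (α : Type*) (L : ℕ) : Type _ := α → Fin L → α

namespace Substitution

/-- The `n`-th power `θ ^ n`, of length `L ^ n`; `θ.power n a` is the level-`n` supertile of `a`. -/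
def power {α : Type*} {L : ℕ} (θ : Substitution α L) : (n : ℕ) → Substitution α (L ^ n)
  | 0, a, _ => a
  | n + 1, a, i =>
    θ (θ.power n a (Fin.cast (pow_succ L n) i).divNat) (Fin.cast (pow_succ L n) i).modNat

/-- Some power `θ ^ k` is such that every letter occurs in every `θ ^ k (a)`. -/
def IsPrimitive {α : Type*} {L : ℕ} (θ : Substitution α L) : Prop :=
  ∃ k : ℕ, 1 ≤ k ∧ ∀ a b : α, ∃ i, θ.power k a i = b

/-- The word `w` occurs in some supertile `θ ^ k (a)` with `k ≥ 1`. -/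
def InLanguage {α : Type*} {L : ℕ} (θ : Substitution α L) {l : ℕ} (w : Fin l → α) : Prop :=
  ∃ (a : α) (k : ℕ) (j : ℕ), 1 ≤ k ∧
    ∀ i : Fin l, ∃ h : j + i < L ^ k, w i = θ.power k a ⟨j + i, h⟩

/-- The subshift of `θ`: all bi-infinite sequences all of whose finite words lie in the language
of `θ`. -/
def subshift {α : Type*} [TopologicalSpace α] [DiscreteTopology α] {L : ℕ}
    (θ : Substitution α L) : Subshift α ℤ where
  carrier := {x | ∀ (m : ℤ) (l : ℕ), θ.InLanguage fun i : Fin l => x (m + (i : ℕ))}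
  isClosed := by
    simp only [Set.ofPred_forall]
    refine isClosed_iInter fun m => isClosed_iInter fun l => ?_
    exact (isClosed_discrete {w : Fin l → α | θ.InLanguage w}).preimage
      (f := fun x : ℤ → α => fun i : Fin l => x (m + (i : ℕ))) (by fun_prop)
  mapsTo := by
    intro g x hx m l
    simpa only [shift_apply, add_assoc] using hx (g + m) l

/-- The space `X_θ` of points of the subshift of `θ`, with the topology induced by `α ^ ℤ`. -/
abbrev Hull {α : Type*} [TopologicalSpace α] [DiscreteTopology α] {L : ℕ}
    (θ : Substitution α L) : Type _ := {x : ℤ → α // x ∈ θ.subshift.carrier}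

/-- The shift `σ ^ n` on `X_θ`, `(σ ^ n x) i = x (n + i)`. -/
def hullShift {α : Type*} [TopologicalSpace α] [DiscreteTopology α] {L : ℕ}
    (θ : Substitution α L) (n : ℤ) (x : θ.Hull) : θ.Hull :=
  ⟨shift n x.1, θ.subshift.mapsTo n x.2⟩

/-- No point of `X_θ` has a non-zero period. -/
def IsAperiodic {α : Type*} [TopologicalSpace α] [DiscreteTopology α] {L : ℕ}
    (θ : Substitution α L) : Prop :=
  ∀ (x : θ.Hull) (n : ℤ), n ≠ 0 → θ.hullShift n x ≠ x

/-- The action of `θ` on bi-infinite sequences: the word `θ (x q)` is placed on the positions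
`L * q, …, L * q + L - 1`. -/
def inflate {α : Type*} {L : ℕ} [NeZero L] (θ : Substitution α L) (x : ℤ → α) : ℤ → α :=
  fun i => θ (x (Int.divModEquiv L i).1) (Int.divModEquiv L i).2

/-- The action of `θ` on right-infinite sequences `x 0, x 1, x 2, …`. -/
def inflateRight {α : Type*} {L : ℕ} [NeZero L] (θ : Substitution α L) (x : ℕ → α) : ℕ → α :=
  fun i => θ (x (Nat.divModEquiv L i).1) (Nat.divModEquiv L i).2

/-- The action of `θ` on left-infinite sequences `…, x 2, x 1, x 0`, where the index counts the
distance to the rightmost entry. -/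
def inflateLeft {α : Type*} {L : ℕ} [NeZero L] (θ : Substitution α L) (x : ℕ → α) : ℕ → α :=
  fun i => θ (x (Nat.divModEquiv L i).1) (Fin.rev (Nat.divModEquiv L i).2)

/-- There are no two left-infinite fixed points that differ exactly in the `0`-th entry. -/
def IsStronglyLeftInjective {α : Type*} {L : ℕ} [NeZero L] (θ : Substitution α L) : Prop :=
  ¬ ∃ x y : ℕ → α, θ.inflateLeft x = x ∧ θ.inflateLeft y = y ∧
    x 0 ≠ y 0 ∧ ∀ i, i ≠ 0 → x i = y i

/-- There are no two right-infinite fixed points that differ exactly in the `0`-th entry. -/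
def IsStronglyRightInjective {α : Type*} {L : ℕ} [NeZero L] (θ : Substitution α L) : Prop :=
  ¬ ∃ x y : ℕ → α, θ.inflateRight x = x ∧ θ.inflateRight y = y ∧
    x 0 ≠ y 0 ∧ ∀ i, i ≠ 0 → x i = y i

/-- Strongly left-injective and strongly right-injective. -/
def IsStronglyInjective {α : Type*} {L : ℕ} [NeZero L] (θ : Substitution α L) : Prop :=
  θ.IsStronglyLeftInjective ∧ θ.IsStronglyRightInjective

/-- The self-homeomorphism `Φ` of `X_θ` is an extended symmetry with linear part
`A ∈ GL(1, ℤ) = {1, -1}`, that is `Φ ∘ σ ^ n = σ ^ (A n) ∘ Φ` for all `n`. -/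
def IsExtendedSymmetry {α : Type*} [TopologicalSpace α] [DiscreteTopology α] {L : ℕ}
    (θ : Substitution α L) (Φ : θ.Hull ≃ₜ θ.Hull) (A : ℤˣ) : Prop :=
  ∀ (n : ℤ) (x : θ.Hull), Φ (θ.hullShift n x) = θ.hullShift ((A : ℤ) * n) (Φ x)

/-- `Φ` has radius zero, with linear part `A` and local map `τ`: `Φ(x)_n = τ (x_{A⁻¹ n})`. -/
def IsRadiusZero {α : Type*} [TopologicalSpace α] [DiscreteTopology α] {L : ℕ}
    (θ : Substitution α L) (Φ : θ.Hull ≃ₜ θ.Hull) (τ : α → α) (A : ℤˣ) : Prop :=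
  ∀ (x : θ.Hull) (n : ℤ), (Φ x).1 n = τ (x.1 (((A⁻¹ : ℤˣ) : ℤ) * n))

/-- The action of `A ∈ {1, -1}` on the block `{0, …, m - 1}` about its centre: the identity for
`A = 1` and the reflection `i ↦ m - 1 - i` for `A = -1`. -/
def blockAct (A : ℤˣ) {m : ℕ} (i : Fin m) : Fin m := if A = 1 then i else Fin.rev i

/-- `Φ` is a supertile-shuffling extended symmetry: it is the radius-zero extended symmetry given
by a permutation `τ` of the letters and an `A ∈ {1, -1}` such that, for all large `n`,
`θ ^ n (τ a)` is `θ ^ n (a)` transformed by `A` about its centre and relabelled by `τ`. -/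
def IsSupertileShuffling {α : Type*} [TopologicalSpace α] [DiscreteTopology α] {L : ℕ}
    (θ : Substitution α L) (Φ : θ.Hull ≃ₜ θ.Hull) : Prop :=
  ∃ (τ : Equiv.Perm α) (A : ℤˣ), θ.IsExtendedSymmetry Φ A ∧ θ.IsRadiusZero Φ τ A ∧
    ∃ N : ℕ, ∀ n ≥ N, ∀ (a : α) (i : Fin (L ^ n)),
      θ.power n (τ a) i = τ (θ.power n a (blockAct A⁻¹ i))

/-- `π` is the tiling factor map to the `p`-adic odometer: for every `n` the residue
`j ∈ {0, …, p ^ n - 1}` of `π x` modulo `p ^ n` is the position of the origin in the level-`n`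
supertile of `x` that covers it, i.e. `x = σ ^ j (θ ^ n (y))` for some `y ∈ X_θ`. -/
def IsTilingFactor {α : Type*} [TopologicalSpace α] [DiscreteTopology α] {p : ℕ}
    [Fact p.Prime] (θ : Substitution α p) (π : θ.Hull → ℤ_[p]) : Prop :=
  ∀ (x : θ.Hull) (n : ℕ), ∃ (y : θ.Hull) (j : ℕ), j < p ^ n ∧
    PadicInt.toZModPow n (π x) = (j : ZMod (p ^ n)) ∧
    x.1 = shift (j : ℤ) (θ.inflate^[n] y.1)

end Substitution

/-- `π : X → A` exhibits the rotation by `g` on the compact abelian group `A` as the maximal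
equicontinuous factor of the dynamical system `(X, T)`: it is a factor map, and every factor map
`f` to an equicontinuous system `(Y, S)` on a compact Hausdorff space factors through `π`. -/
structure IsMaximalEquicontinuousFactor.{u, v} {X : Type u} [TopologicalSpace X] (T : X → X)
    {A : Type v} [AddCommGroup A] [TopologicalSpace A] [IsTopologicalAddGroup A]
    [CompactSpace A] [T2Space A] (g : A) (π : X → A) : Prop where
  continuous : Continuous π
  surjective : Function.Surjective π
  equivariant : ∀ x, π (T x) = π x + g
  maximal : ∀ (Y : Type u) [UniformSpace Y] [CompactSpace Y] [T2Space Y] (S : Y ≃ₜ Y),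
    (UniformEquicontinuous fun n : ℤ => ((S ^ n : Y ≃ₜ Y) : Y → Y)) →
    ∀ f : X → Y, Continuous f → Function.Surjective f → (∀ x, f (T x) = S (f x)) →
      ∃ h : A → Y, Continuous h ∧ (∀ z, h (z + g) = S (h z)) ∧ f = h ∘ π

/-- `κ` is a `κ`-value of `Φ` with respect to the factor map `π : X → A`: the map that `Φ` induces
on `A` is `z ↦ κ + ζ z` for an automorphism `ζ` of the topological group `A`. -/
def IsKappaValue {X A : Type*} [AddCommGroup A] [TopologicalSpace A] (π : X → A) (Φ : X → X)
    (κ : A) : Prop :=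
  ∃ ζ : A ≃ₜ+ A, ∀ x, π (Φ x) = κ + ζ (π x)

/-- The alphabet `{0, 1, 2, 3, 5, 6}`. -/
inductive Letter : Type
  | l0 | l1 | l2 | l3 | l5 | l6
  deriving DecidableEq

instance : TopologicalSpace Letter := ⊥

instance : DiscreteTopology Letter := ⟨rfl⟩

open Letter in
/-- The substitution `0 ↦ 30261`, `1 ↦ 31603`, `2 ↦ 52603`, `3 ↦ 53025`, `5 ↦ 15261`,
`6 ↦ 16025`. -/
def rho : Substitution Letter 5
  | l0 => ![l3, l0, l2, l6, l1]
  | l1 => ![l3, l1, l6, l0, l3]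
  | l2 => ![l5, l2, l6, l0, l3]
  | l3 => ![l5, l3, l0, l2, l5]
  | l5 => ![l1, l5, l2, l6, l1]
  | l6 => ![l1, l6, l0, l2, l5]

open Letter in
/-- The letter exchange `(0 3)(1 6)(2 5)`. -/
def tau : Equiv.Perm Letter := Equiv.swap l0 l3 * Equiv.swap l1 l6 * Equiv.swap l2 l5

instance : Fact (Nat.Prime 5) := ⟨by norm_num⟩

/-! Three features of the table of `rho` drive the proof. Column 1 is the identity, `rho a 1 = a`.
Columns 0 and 4 contain only odd letters and columns 2 and 3 only even ones, so five consecutive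
parities reveal the position inside a level-one supertile, and reading off column 1 then inverts the
substitution. Finally, reversal with relabelling by `tau` reflects blocks about column 1 instead of
their centre: columns 0, 1, 2 of `rho a` become columns 2, 1, 0 of `rho (tau a)`, while columns 3, 4
spill over into columns 4, 3 of the neighbouring block, which works because only legal pairs of
letters are adjacent.

Iterated desubstitution yields the digits of `odometer`, the only possible tiling factor. The
displaced reflection turns `s = odometer (Φ x) + odometer x` into `2 + 5 * s'`, with `s'` the same
sum for the desubstituted point; hence `2 * s + 1` is divisible by every power of 5, and κ = -1/2 is
not an integer. Supertile shuffling fails because both end columns are odd and `tau` flips parity.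
Strong injectivity holds because column 1 determines its whole block.

For maximality (`eq_of_odometer_eq`), an equicontinuous factor `f` is tested on σ^j ρ^n(u) for large
`n` and `j` near the boundary of two supertiles. There `f` nearly depends only on the letters of `u`
at 0 and 1, and equicontinuity makes the resulting relation shift-invariant. Coincidences in the
table then link all points with a common digit. -/

namespace Substitution

/-! ### Substitutions acting on sequences and on the hull -/

section Inflate

variable {α : Type*} {L : ℕ}

theorem inflate_mul_add [NeZero L] (θ : Substitution α L) (x : ℤ → α) (q : ℤ) (c : Fin L) :
    θ.inflate x (L * q + (c : ℕ)) = θ (x q) c := by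
  have h : (L : ℤ) * q + (c : ℕ) = (Int.divModEquiv L).symm (q, c) := by
    rw [Int.divModEquiv_symm_apply]; ring
  simp only [inflate, h, Equiv.apply_symm_apply]

theorem exists_eq_mul_add [NeZero L] (i : ℤ) : ∃ (q : ℤ) (c : Fin L), i = L * q + (c : ℕ) := by
  refine ⟨(Int.divModEquiv L i).1, (Int.divModEquiv L i).2, ?_⟩
  conv_lhs => rw [← (Int.divModEquiv L).symm_apply_apply i, Int.divModEquiv_symm_apply]
  ring

theorem inflate_shift [NeZero L] (θ : Substitution α L) (m : ℤ) (x : ℤ → α) :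
    θ.inflate (shift m x) = shift (L * m) (θ.inflate x) := by
  ext i
  obtain ⟨q, c, rfl⟩ := exists_eq_mul_add (L := L) i
  rw [inflate_mul_add, shift_apply, shift_apply, ← add_assoc, ← mul_add, inflate_mul_add]

theorem iterate_inflate_shift [NeZero L] (θ : Substitution α L) (n : ℕ) (m : ℤ) (x : ℤ → α) :
    θ.inflate^[n] (shift m x) = shift ((L : ℤ) ^ n * m) (θ.inflate^[n] x) := by
  induction n generalizing m x with
  | zero => simp
  | succ n ih =>
    rw [Function.iterate_succ_apply, inflate_shift, ih, ← Function.iterate_succ_apply, pow_succ,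
      mul_assoc]

theorem shift_shift (m k : ℤ) (x : ℤ → α) : shift m (shift k x) = shift (k + m) x := by
  ext i; simp only [shift_apply, add_assoc]

/-- The word `θ ^ n (a)` fills the block of length `L ^ n` of `θ ^ n (x)` that comes from `a`. -/
theorem iterate_inflate_mul_add [NeZero L] (θ : Substitution α L) (n : ℕ) (x : ℤ → α) (q : ℤ)
    (r : Fin (L ^ n)) :
    θ.inflate^[n] x ((L : ℤ) ^ n * q + (r : ℕ)) = θ.power n (x q) r := by
  induction n with
  | zero =>
    obtain ⟨r, hr⟩ := r
    obtain rfl : r = 0 := by simpa using hr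
    simp [power]
  | succ n ih =>
    have hr : ((r : ℕ) : ℤ) = L * ((Fin.cast (pow_succ L n) r).divNat : ℕ) +
        ((Fin.cast (pow_succ L n) r).modNat : ℕ) := by
      simp only [Fin.coe_divNat, Fin.coe_modNat, Fin.val_cast]
      exact_mod_cast (Nat.div_add_mod _ _).symm
    rw [Function.iterate_succ_apply', hr, pow_succ', mul_assoc, ← add_assoc, ← mul_add,
      inflate_mul_add, ih]
    rfl

/-- Blocks of `θ ^ n (x)` and `θ ^ n (y)` that come from the same letter agree. -/
theorem iterate_inflate_congr [NeZero L] (θ : Substitution α L) {n : ℕ} {x y : ℤ → α} {q q' t : ℤ}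
    (h : x q = y q') (h0 : 0 ≤ t) (ht : t < (L : ℤ) ^ n) :
    θ.inflate^[n] x ((L : ℤ) ^ n * q + t) = θ.inflate^[n] y ((L : ℤ) ^ n * q' + t) := by
  lift t to ℕ using h0
  have := iterate_inflate_mul_add θ n x q ⟨t, by exact_mod_cast ht⟩
  have := iterate_inflate_mul_add θ n y q' ⟨t, by exact_mod_cast ht⟩
  simp_all

theorem power_eq_iterate_inflate [NeZero L] (θ : Substitution α L) (n : ℕ) (a : α)
    (r : Fin (L ^ n)) : θ.power n a r = θ.inflate^[n] (fun _ => a) (r : ℕ) := by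
  simpa using (iterate_inflate_mul_add θ n (fun _ => a) 0 r).symm

theorem inLanguage_iff [NeZero L] (θ : Substitution α L) {l : ℕ} (w : Fin l → α) :
    θ.InLanguage w ↔ ∃ (a : α) (k : ℕ) (j : ℕ), 1 ≤ k ∧ ∀ i : Fin l, j + (i : ℕ) < L ^ k ∧
      w i = θ.inflate^[k] (fun _ => a) ((j : ℤ) + (i : ℕ)) := by
  refine exists_congr fun a => exists_congr fun k => exists_congr fun j =>
    and_congr_right fun _ => forall_congr' fun i => ?_
  simp only [power_eq_iterate_inflate, exists_prop, Nat.cast_add]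

variable [TopologicalSpace α] [DiscreteTopology α]

theorem inflate_mem [NeZero L] (θ : Substitution α L) {x : ℤ → α} (hx : x ∈ θ.subshift.carrier) :
    θ.inflate x ∈ θ.subshift.carrier := by
  intro m l
  rw [inLanguage_iff]
  obtain ⟨q₀, c₀, rfl⟩ := exists_eq_mul_add (L := L) m
  obtain ⟨a, k, j, hk, h⟩ := (inLanguage_iff θ _).1 (hx q₀ (l + 1))
  refine ⟨a, k + 1, L * j + c₀, by omega, fun i => ?_⟩
  obtain ⟨t, c, htc⟩ : ∃ (t : ℕ) (c : Fin L), (c₀ : ℕ) + (i : ℕ) = L * t + (c : ℕ) :=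
    ⟨_, ⟨_, Nat.mod_lt _ (NeZero.pos L)⟩, (Nat.div_add_mod _ L).symm⟩
  have hL := NeZero.pos L
  have ht : t < l + 1 := by
    by_contra! hlt
    have h1 : L * (l + 1) ≤ L * t := Nat.mul_le_mul_left L hlt
    have h2 := c₀.2
    have h3 := i.2
    nlinarith
  obtain ⟨h1, h2⟩ := h ⟨t, ht⟩
  simp only at h1 h2
  constructor
  · have h3 : L * (j + t + 1) ≤ L * L ^ k := Nat.mul_le_mul_left L h1
    have h4 := c.2
    rw [pow_succ']
    nlinarith
  · have e1 : (L : ℤ) * q₀ + (c₀ : ℕ) + (i : ℕ) = L * (q₀ + t) + (c : ℕ) := by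
      have : ((c₀ : ℕ) : ℤ) + (i : ℕ) = L * t + (c : ℕ) := by exact_mod_cast htc
      rw [add_assoc, this]; ring
    have e2 : ((L * j + c₀ : ℕ) : ℤ) + (i : ℕ) = L * (j + t) + (c : ℕ) := by
      have : ((c₀ : ℕ) : ℤ) + (i : ℕ) = L * t + (c : ℕ) := by exact_mod_cast htc
      push_cast
      rw [add_assoc, this]; ring
    rw [e1, e2, inflate_mul_add, h2, Function.iterate_succ_apply', inflate_mul_add]

/-- The action of `θ` on its hull. -/
def hullInflate [NeZero L] (θ : Substitution α L) (x : θ.Hull) : θ.Hull :=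
  ⟨θ.inflate x.1, θ.inflate_mem x.2⟩

theorem coe_hullInflate_iterate [NeZero L] (θ : Substitution α L) (n : ℕ) (x : θ.Hull) :
    (θ.hullInflate^[n] x).1 = θ.inflate^[n] x.1 := by
  induction n with
  | zero => rfl
  | succ n ih => rw [Function.iterate_succ_apply', Function.iterate_succ_apply', ← ih]; rfl

theorem hullShift_apply (θ : Substitution α L) (n : ℤ) (x : θ.Hull) (i : ℤ) :
    (θ.hullShift n x).1 i = x.1 (n + i) := shift_apply ..

theorem hullShift_hullShift (θ : Substitution α L) (m k : ℤ) (x : θ.Hull) :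
    θ.hullShift m (θ.hullShift k x) = θ.hullShift (k + m) x := Subtype.ext (shift_shift _ _ _)

theorem hullShift_zero (θ : Substitution α L) (x : θ.Hull) : θ.hullShift 0 x = x := by
  ext i; simp [hullShift_apply]

theorem hullInflate_iterate_hullShift [NeZero L] (θ : Substitution α L) (n : ℕ) (m : ℤ)
    (x : θ.Hull) : θ.hullInflate^[n] (θ.hullShift m x) =
      θ.hullShift ((L : ℤ) ^ n * m) (θ.hullInflate^[n] x) := by
  apply Subtype.ext
  rw [coe_hullInflate_iterate]
  simp only [hullShift, coe_hullInflate_iterate, iterate_inflate_shift]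

instance compactSpace_hull [Finite α] (θ : Substitution α L) : CompactSpace θ.Hull :=
  isCompact_iff_compactSpace.1 θ.subshift.isClosed.isCompact

end Inflate

end Substitution

/-! ### Recognizability of `rho` from parities -/

open Substitution Letter
open Filter Topology Uniformity

instance : Fintype Letter :=
  ⟨{.l0, .l1, .l2, .l3, .l5, .l6}, by intro x; cases x <;> decide⟩

namespace Letter

/-- Whether the letter is one of `1, 3, 5`. -/
def isOdd : Letter → Bool
  | l1 | l3 | l5 => true
  | l0 | l2 | l6 => false

/-- The two-letter words of the language of `rho`. -/
def Adj : Letter → Letter → Bool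
  | l0, l2 | l0, l3 | l1, l5 | l1, l6 | l2, l5 | l2, l6 => true
  | l3, l0 | l3, l1 | l5, l2 | l5, l3 | l6, l0 | l6, l1 => true
  | _, _ => false

end Letter


theorem rho_inflate (x : ℤ → Letter) (q : ℤ) (c : Fin 5) :
    rho.inflate x (5 * q + (c : ℕ)) = rho (x q) c := mod_cast inflate_mul_add rho x q c

theorem rho_inflate_one (x : ℤ → Letter) (q : ℤ) : rho.inflate x (5 * q + 1) = x q := by
  have := rho_inflate x q 1
  simp only [Fin.val_one, Nat.cast_one] at this
  rw [this]
  cases x q <;> rfl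

theorem exists_eq_five_mul_add (i : ℤ) : ∃ (q : ℤ) (c : Fin 5), i = 5 * q + (c : ℕ) :=
  mod_cast exists_eq_mul_add (L := 5) i

/-- The parities of the letters of `x` are those of `σ ^ d (ρ (y))`. -/
def HasPhase (x : ℤ → Letter) (s : Set ℤ) (d : ℤ) : Prop :=
  ∀ i ∈ s, (((i + d) % 5 = 0 ∨ (i + d) % 5 = 4) → (x i).isOdd = true) ∧
    (((i + d) % 5 = 2 ∨ (i + d) % 5 = 3) → (x i).isOdd = false)

theorem hasPhase_inflate (y : ℤ → Letter) (d : ℤ) :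
    HasPhase (shift d (rho.inflate y)) Set.univ d := by
  intro i _
  rw [shift_apply]
  obtain ⟨q, c, hc⟩ := exists_eq_five_mul_add (d + i)
  have hi : (i + d) % 5 = (c : ℕ) := by have := c.2; omega
  rw [hc, rho_inflate, hi]
  generalize y q = a
  clear hc hi
  revert a c
  decide

/-- The position in `0, …, 4` of the origin in its level-one supertile, read off from the parities
of five letters. -/
def digitOfParities : Bool → Bool → Bool → Bool → Bool → ℕ
  | true, _, false, false, true => 0
  | _, false, false, true, true => 1
  | false, false, true, true, _ => 2
  | false, true, true, _, false => 3
  | _, _, _, _, _ => 4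

/-- The position of the origin in its level-one supertile. -/
def digit (x : ℤ → Letter) : ℕ :=
  digitOfParities (x 0).isOdd (x 1).isOdd (x 2).isOdd (x 3).isOdd (x 4).isOdd

theorem digit_lt (x : ℤ → Letter) : digit x < 5 := by
  unfold digit
  generalize (x 0).isOdd = a, (x 1).isOdd = b, (x 2).isOdd = c, (x 3).isOdd = d, (x 4).isOdd = e
  revert a b c d e
  decide

theorem digit_eq_of_hasPhase {x : ℤ → Letter} {d : ℤ} (h : HasPhase x (Set.Icc 0 4) d) :
    (digit x : ℤ) = d % 5 := by
  have h0 := h 0 (by simp)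
  have h1 := h 1 (by simp)
  have h2 := h 2 (by simp)
  have h3 := h 3 (by simp)
  have h4 := h 4 (by simp)
  have hd : d % 5 = 0 ∨ d % 5 = 1 ∨ d % 5 = 2 ∨ d % 5 = 3 ∨ d % 5 = 4 := by omega
  have key : ∀ k : ℤ, (k + d) % 5 = (k + d % 5) % 5 := by intro k; omega
  simp only [key] at h0 h1 h2 h3 h4
  unfold digit
  generalize (x 0).isOdd = a, (x 1).isOdd = b, (x 2).isOdd = c, (x 3).isOdd = d', (x 4).isOdd = e
    at *
  rcases hd with hd | hd | hd | hd | hd <;> rw [hd] at h0 h1 h2 h3 h4 ⊢ <;>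
    norm_num at h0 h1 h2 h3 h4 <;> revert a b c d' e <;> decide

theorem digit_shift_inflate (y : ℤ → Letter) (d : ℤ) :
    (digit (shift d (rho.inflate y)) : ℤ) = d % 5 :=
  digit_eq_of_hasPhase fun i _ => hasPhase_inflate y d i trivial

/-- A central window of a point of the hull, desubstituted once. -/
theorem exists_window {x : ℤ → Letter} (hx : x ∈ rho.subshift.carrier) {M : ℤ} (hM : 4 ≤ M) :
    ∃ (a : Letter) (k : ℕ) (s : ℤ), 1 ≤ k ∧ ∀ i, -M ≤ i → i ≤ M →
      0 ≤ 5 * s + digit x + i ∧ 5 * s + digit x + i < 5 ^ (k + 1) ∧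
      x i = rho.inflate (rho.inflate^[k] fun _ => a) (5 * s + digit x + i) := by
  obtain ⟨a, k, j, hk, h⟩ := (inLanguage_iff rho _).1 (hx (-M) (2 * M + 1).toNat)
  obtain ⟨k, rfl⟩ : ∃ k', k = k' + 1 := ⟨k - 1, by omega⟩
  have key : ∀ i, -M ≤ i → i ≤ M → j + M + i < 5 ^ (k + 1) ∧
      x i = rho.inflate (rho.inflate^[k] fun _ => a) (j + M + i) := by
    intro i h1 h2
    obtain ⟨h3, h4⟩ := h ⟨(M + i).toNat, by omega⟩
    have e : (((M + i).toNat : ℕ) : ℤ) = M + i := by omega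
    constructor
    · zify at h3
      rw [e] at h3
      linarith
    · rw [Function.iterate_succ_apply'] at h4
      simp only [e] at h4
      rw [show -M + (M + i) = i by ring, show (j : ℤ) + (M + i) = j + M + i by ring] at h4
      exact h4
  have hd : (digit x : ℤ) = (j + M) % 5 := by
    apply digit_eq_of_hasPhase
    intro i hi
    rw [(key i (by have := hi.1; omega) (by have := hi.2; omega)).2]
    have := hasPhase_inflate (rho.inflate^[k] fun _ => a) (j + M) i trivial
    rwa [shift_apply] at this
  refine ⟨a, k, (j + M) / 5, ?_, fun i h1 h2 => ?_⟩
  -- At least nine letters do not fit into a single `rho a`. This leaves `k ≥ 1`, as the language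
  -- requires of the desubstituted word.
  · by_contra! hk0
    obtain rfl : k = 0 := by omega
    have := (key M (by omega) le_rfl).1
    omega
  · have e : 5 * ((j + M) / 5) + digit x + i = j + M + i := by rw [hd]; omega
    rw [e]
    exact ⟨by omega, key i h1 h2⟩

/-- The point `y` with `x = σ ^ d (ρ (y))`, where `d` is the digit of `x`. -/
def desubstitute (x : ℤ → Letter) : ℤ → Letter := fun q => x (5 * q + 1 - digit x)

/-- Position `5 * q + 1` of an inflated sequence carries the letter `q` of its preimage; this letter
determines the rest of the block. -/
theorem shift_inflate_desubstitute {x : ℤ → Letter} (hx : x ∈ rho.subshift.carrier) :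
    shift (digit x : ℤ) (rho.inflate (desubstitute x)) = x := by
  ext i
  obtain ⟨q, c, hc⟩ := exists_eq_five_mul_add (digit x + i)
  have hc5 := c.2
  obtain ⟨a, k, s, -, h⟩ := exists_window hx (M := |i| + 4) (by have := abs_nonneg i; omega)
  have hi1 := neg_abs_le i
  have hi2 := le_abs_self i
  obtain ⟨-, -, h1⟩ := h i (by omega) (by omega)
  obtain ⟨-, -, h2⟩ := h (5 * q + 1 - digit x) (by omega) (by omega)
  rw [show 5 * s + digit x + (5 * q + 1 - digit x) = 5 * (s + q) + 1 by ring,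
    rho_inflate_one] at h2
  rw [show 5 * s + digit x + i = 5 * (s + q) + (c : ℕ) by rw [mul_add]; omega, rho_inflate] at h1
  rw [shift_apply, hc, rho_inflate, h1]
  exact congrArg (rho · c) h2

theorem desubstitute_mem {x : ℤ → Letter} (hx : x ∈ rho.subshift.carrier) :
    desubstitute x ∈ rho.subshift.carrier := by
  intro m l
  rw [inLanguage_iff]
  have hd := digit_lt x
  obtain ⟨a, k, s, hk, h⟩ := exists_window hx (M := 5 * |m| + 5 * l + 5)
    (by have := abs_nonneg m; omega)
  have hm1 := neg_abs_le m
  have hm2 := le_abs_self m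
  have key : ∀ i : ℕ, i ≤ l → 0 ≤ s + m + i ∧ s + m + i < 5 ^ k ∧
      desubstitute x (m + i) = rho.inflate^[k] (fun _ => a) (s + m + i) := by
    intro i hi
    obtain ⟨h0, h1, h2⟩ := h (5 * (m + i) + 1 - digit x) (by omega) (by omega)
    rw [show 5 * s + digit x + (5 * (m + i) + 1 - digit x) = 5 * (s + m + i) + 1 by ring] at h0 h1 h2
    rw [rho_inflate_one] at h2
    rw [pow_succ] at h1
    exact ⟨by omega, by omega, h2⟩
  have e : (((s + m).toNat : ℕ) : ℤ) = s + m := by have := (key 0 (by omega)).1; omega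
  refine ⟨a, k, (s + m).toNat, hk, fun i => ?_⟩
  obtain ⟨-, h1, h2⟩ := key i i.2.le
  refine ⟨?_, ?_⟩
  · zify; rw [e]; exact h1
  · rw [e]; exact h2

theorem desubstitute_shift_inflate (y : ℤ → Letter) (j : ℤ) :
    desubstitute (shift j (rho.inflate y)) = shift (j / 5) y := by
  ext q
  rw [desubstitute, digit_shift_inflate, shift_apply, shift_apply,
    show j + (5 * q + 1 - j % 5) = 5 * (j / 5 + q) + 1 by omega, rho_inflate_one]

/-! ### The odometer as the unique tiling factor -/

theorem PadicInt.pow_dvd_sub_iff {p : ℕ} [Fact p.Prime] (n : ℕ) (x y : ℤ_[p]) :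
    (p : ℤ_[p]) ^ n ∣ x - y ↔ PadicInt.toZModPow n x = PadicInt.toZModPow n y := by
  rw [← sub_eq_zero, ← map_sub, ← RingHom.mem_ker, PadicInt.ker_toZModPow,
    Ideal.mem_span_singleton]

theorem PadicInt.eq_of_forall_pow_dvd_sub {p : ℕ} [Fact p.Prime] {x y : ℤ_[p]}
    (h : ∀ n : ℕ, (p : ℤ_[p]) ^ n ∣ x - y) : x = y :=
  PadicInt.ext_of_toZModPow.1 fun n => (PadicInt.pow_dvd_sub_iff n x y).1 (h n)

/-- Desubstitution as a self-map of the hull of `rho`. -/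
def hullDesubstitute (x : rho.Hull) : rho.Hull := ⟨desubstitute x.1, desubstitute_mem x.2⟩

theorem hullShift_hullInflate_desubstitute (x : rho.Hull) :
    rho.hullShift (digit x.1) (rho.hullInflate (hullDesubstitute x)) = x :=
  Subtype.ext (shift_inflate_desubstitute x.2)

theorem hullDesubstitute_shift_inflate (j : ℤ) (y : rho.Hull) :
    hullDesubstitute (rho.hullShift j (rho.hullInflate y)) = rho.hullShift (j / 5) y :=
  Subtype.ext (desubstitute_shift_inflate y.1 j)

theorem digit_hullShift_hullInflate (j : ℤ) (y : rho.Hull) :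
    (digit (rho.hullShift j (rho.hullInflate y)).1 : ℤ) = j % 5 := digit_shift_inflate y.1 j

theorem continuous_digit : Continuous fun x : rho.Hull => digit x.1 := by
  have h : ∀ i : ℤ, Continuous fun x : rho.Hull => (x.1 i).isOdd := fun i =>
    (continuous_of_discreteTopology (f := isOdd)).comp
      ((continuous_apply i).comp continuous_subtype_val)
  exact (continuous_of_discreteTopology
    (f := fun b : Bool × Bool × Bool × Bool × Bool =>
      digitOfParities b.1 b.2.1 b.2.2.1 b.2.2.2.1 b.2.2.2.2)).comp
    ((h 0).prodMk ((h 1).prodMk ((h 2).prodMk ((h 3).prodMk (h 4)))))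

/-- The digit is locally constant, and for a fixed digit each coordinate is a projection. -/
theorem continuous_hullDesubstitute : Continuous hullDesubstitute := by
  refine Continuous.subtype_mk (continuous_pi fun q => ?_) _
  rw [continuous_iff_continuousAt]
  intro x
  have h : ∀ᶠ y in nhds x, digit y.1 = digit x.1 :=
    continuous_digit.continuousAt.eventually_mem ((isOpen_discrete {digit x.1}).mem_nhds rfl)
  have h' : ContinuousAt (fun y : rho.Hull => y.1 (5 * q + 1 - digit x.1)) x :=
    ((continuous_apply _).comp continuous_subtype_val).continuousAt
  refine h'.congr ?_
  filter_upwards [h] with y hy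
  simp only [desubstitute, hy]

/-- The tiling factor map of `rho`: the `k`-th digit of `odometer x` is the position of the level-`k`
supertile at the origin in the supertile of the next level. -/
noncomputable def odometer (x : rho.Hull) : ℤ_[5] :=
  ∑' k : ℕ, (digit (hullDesubstitute^[k] x).1 : ℤ_[5]) * 5 ^ k

theorem norm_natCast_mul_five_pow_le (m k : ℕ) : ‖(m : ℤ_[5]) * 5 ^ k‖ ≤ (1 / 5 : ℝ) ^ k := by
  have h5 : ‖(5 : ℤ_[5])‖ = 1 / 5 := by
    have := PadicInt.norm_p (p := 5)
    simpa using this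
  calc ‖(m : ℤ_[5]) * 5 ^ k‖ ≤ 1 * ‖(5 : ℤ_[5]) ^ k‖ := by
        rw [norm_mul]
        exact mul_le_mul_of_nonneg_right (PadicInt.norm_le_one _) (norm_nonneg _)
    _ = (1 / 5 : ℝ) ^ k := by rw [norm_pow, h5, one_mul]

theorem summable_one_fifth_pow : Summable fun k : ℕ => (1 / 5 : ℝ) ^ k :=
  summable_geometric_of_lt_one (by norm_num) (by norm_num)

theorem odometer_eq (x : rho.Hull) :
    odometer x = digit x.1 + 5 * odometer (hullDesubstitute x) := by
  have hs : ∀ y, Summable fun k : ℕ => (digit (hullDesubstitute^[k] y).1 : ℤ_[5]) * 5 ^ k :=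
    fun y => summable_one_fifth_pow.of_norm_bounded fun k => norm_natCast_mul_five_pow_le _ _
  rw [odometer, (hs x).tsum_eq_zero_add, odometer, ← (hs _).tsum_mul_left]
  simp only [Function.iterate_zero, id, pow_zero, mul_one, Function.iterate_succ_apply]
  congr 1
  exact tsum_congr fun k => by ring

theorem continuous_odometer : Continuous odometer := by
  refine continuous_tsum (fun k => ?_) summable_one_fifth_pow
    fun k x => norm_natCast_mul_five_pow_le _ _
  have h : Continuous fun x : rho.Hull => digit (hullDesubstitute^[k] x).1 :=
    continuous_digit.comp (continuous_hullDesubstitute.iterate k)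
  exact ((continuous_of_discreteTopology (f := fun m : ℕ => (m : ℤ_[5]))).comp h).mul
    continuous_const

/-- One desubstitution removes the last base-5 digit of `j`, leaving `j / 5`. Thus the offset in any
level-`n` decomposition is forced modulo `5 ^ n`, which gives equivariance and uniqueness of the
tiling factor. -/
theorem pow_dvd_odometer_sub (n : ℕ) (j : ℤ) (y : rho.Hull) :
    (5 : ℤ_[5]) ^ n ∣ odometer (rho.hullShift j (rho.hullInflate^[n] y)) - j := by
  induction n generalizing j with
  | zero => simp
  | succ n ih =>
    rw [Function.iterate_succ_apply', odometer_eq, hullDesubstitute_shift_inflate]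
    have h := digit_hullShift_hullInflate j (rho.hullInflate^[n] y)
    have hj : (j : ℤ_[5]) =
        (digit (rho.hullShift j (rho.hullInflate (rho.hullInflate^[n] y))).1 : ℤ_[5])
          + 5 * ((j / 5 : ℤ) : ℤ_[5]) := by
      rw [← Int.cast_natCast, h]
      exact_mod_cast (Int.emod_add_mul_ediv j 5).symm
    conv_rhs => enter [2]; rw [hj]
    rw [add_sub_add_left_eq_sub, ← mul_sub, pow_succ']
    exact mul_dvd_mul_left _ (ih _)

theorem exists_hullShift_hullInflate_iterate (n : ℕ) (x : rho.Hull) :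
    ∃ (y : rho.Hull) (j : ℕ), j < 5 ^ n ∧ x = rho.hullShift j (rho.hullInflate^[n] y) := by
  induction n generalizing x with
  | zero => exact ⟨x, 0, by simp, (rho.hullShift_zero x).symm⟩
  | succ n ih =>
    obtain ⟨y, j, hj, h⟩ := ih (hullDesubstitute x)
    have hd := digit_lt x.1
    refine ⟨y, 5 * j + digit x.1, by rw [pow_succ]; omega, ?_⟩
    conv_lhs => rw [← hullShift_hullInflate_desubstitute x, h]
    have := rho.hullInflate_iterate_hullShift 1 j (rho.hullInflate^[n] y)
    simp only [Function.iterate_one] at this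
    rw [this, hullShift_hullShift, Function.iterate_succ_apply']
    simp

theorem odometer_hullShift (m : ℤ) (x : rho.Hull) :
    odometer (rho.hullShift m x) = odometer x + m := by
  apply PadicInt.eq_of_forall_pow_dvd_sub
  intro n
  obtain ⟨y, j, -, rfl⟩ := exists_hullShift_hullInflate_iterate n x
  rw [hullShift_hullShift]
  have h := dvd_sub (pow_dvd_odometer_sub n (j + m) y) (pow_dvd_odometer_sub n j y)
  push_cast at h ⊢
  convert h using 1
  ring

theorem odometer_hullInflate (x : rho.Hull) : odometer (rho.hullInflate x) = 5 * odometer x := by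
  have h1 := digit_hullShift_hullInflate 0 x
  have h2 := hullDesubstitute_shift_inflate 0 x
  rw [hullShift_zero] at h1 h2
  rw [odometer_eq, h2]
  simp_all [hullShift_zero]

theorem odometer_hullInflate_iterate (n : ℕ) (x : rho.Hull) :
    odometer (rho.hullInflate^[n] x) = 5 ^ n * odometer x := by
  induction n with
  | zero => simp
  | succ n ih => rw [Function.iterate_succ_apply', odometer_hullInflate, ih, pow_succ', mul_assoc]

theorem isTilingFactor_iff (π : rho.Hull → ℤ_[5]) : rho.IsTilingFactor π ↔ π = odometer := by
  have key : ∀ (z : ℤ_[5]) (n j : ℕ),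
      PadicInt.toZModPow n z = (j : ZMod (5 ^ n)) ↔ (5 : ℤ_[5]) ^ n ∣ z - j := by
    intro z n j
    have := PadicInt.pow_dvd_sub_iff n z j
    rw [map_natCast] at this
    exact this.symm
  constructor
  · intro h
    ext1 x
    apply PadicInt.eq_of_forall_pow_dvd_sub
    intro n
    obtain ⟨y, j, -, h1, h2⟩ := h x n
    rw [key] at h1
    have hx : x = rho.hullShift j (rho.hullInflate^[n] y) :=
      Subtype.ext (by simp only [h2, hullShift, coe_hullInflate_iterate])
    have h3 := pow_dvd_odometer_sub n j y
    rw [← hx] at h3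
    have := dvd_sub h1 h3
    simpa using this
  · rintro rfl x n
    obtain ⟨y, j, hj, h⟩ := exists_hullShift_hullInflate_iterate n x
    refine ⟨y, j, hj, ?_, ?_⟩
    · rw [key, h]
      exact_mod_cast pow_dvd_odometer_sub n j y
    · conv_lhs => rw [h]
      simp only [hullShift, coe_hullInflate_iterate]

theorem rho_isAperiodic : rho.IsAperiodic := by
  intro x n hn h
  have := odometer_hullShift n x
  rw [h] at this
  exact hn (by simpa using this)

/-! ### Membership in the subshift through legal pairs -/

/-- All two-letter words of `x` belong to the language of `rho`. -/
def IsAdjChain (x : ℤ → Letter) : Prop := ∀ i, Adj (x i) (x (i + 1)) = true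

/-- Pairs inside a block are always legal; a pair across a boundary is legal if the two parent
letters form a legal pair. -/
theorem adj_inflate {y : ℤ → Letter} {q : ℤ} (c : Fin 5)
    (h : c = 4 → Adj (y q) (y (q + 1)) = true) :
    Adj (rho.inflate y (5 * q + (c : ℕ))) (rho.inflate y (5 * q + (c : ℕ) + 1)) = true := by
  by_cases hc : c = 4
  · subst hc
    have h1 := rho_inflate y (q + 1) 0
    rw [show 5 * (q + 1) + (((0 : Fin 5) : ℕ) : ℤ) = 5 * q + (((4 : Fin 5) : ℕ) : ℤ) + 1 by
      simp; ring] at h1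
    rw [rho_inflate, h1]
    replace h := h rfl
    revert h
    generalize y q = a, y (q + 1) = b
    revert a b
    decide
  · obtain ⟨c', hc'⟩ : ∃ c' : Fin 4, c = c'.castSucc :=
      ⟨c.castPred hc, (Fin.castSucc_castPred c hc).symm⟩
    subst hc'
    have h1 := rho_inflate y q c'.succ
    rw [show 5 * q + ((c'.succ : ℕ) : ℤ) = 5 * q + ((c'.castSucc : ℕ) : ℤ) + 1 by
      simp; ring] at h1
    rw [rho_inflate, h1]
    clear hc h h1
    generalize y q = a
    revert a c'
    decide

theorem adj_iterate_inflate (a : Letter) (k : ℕ) {t : ℤ} (h0 : 0 ≤ t) (ht : t + 1 < 5 ^ k) :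
    Adj (rho.inflate^[k] (fun _ => a) t) (rho.inflate^[k] (fun _ => a) (t + 1)) = true := by
  induction k generalizing t with
  | zero => simp at ht; omega
  | succ k ih =>
    obtain ⟨q, c, rfl⟩ := exists_eq_five_mul_add t
    have hc := c.2
    rw [Function.iterate_succ_apply']
    refine adj_inflate c fun h4 => ih (by omega) ?_
    rw [pow_succ] at ht
    subst h4
    simp at ht
    omega

theorem isAdjChain_of_mem {x : ℤ → Letter} (hx : x ∈ rho.subshift.carrier) : IsAdjChain x := by
  intro i
  obtain ⟨a, k, j, -, h⟩ := (inLanguage_iff rho _).1 (hx i 2)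
  have h0 := h 0
  have h1 := h 1
  simp only [Fin.val_zero, Fin.val_one, Nat.cast_zero, Nat.cast_one, add_zero] at h0 h1
  rw [h0.2, h1.2]
  exact adj_iterate_inflate a k (by omega) (by exact_mod_cast h1.1)

theorem exists_power_two_eq {a b : Letter} (h : Adj a b = true) :
    ∃ s : Fin 24, rho.power 2 l0 ⟨s, by omega⟩ = a ∧ rho.power 2 l0 ⟨s + 1, by omega⟩ = b := by
  revert a b
  decide

/-- A sequence that can be desubstituted indefinitely into sequences of legal two-letter words
belongs to the subshift. -/
theorem mem_subshift_of_forall_exists {x : ℤ → Letter}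
    (h : ∀ n : ℕ, ∃ (j : ℤ) (y : ℤ → Letter), IsAdjChain y ∧ x = shift j (rho.inflate^[n] y)) :
    x ∈ rho.subshift.carrier := by
  intro m l
  rw [inLanguage_iff]
  obtain ⟨j, y, hy, rfl⟩ := h l
  have hl : (l : ℤ) < 5 ^ l := by exact_mod_cast Nat.lt_pow_self (by norm_num)
  have hpos : (0 : ℤ) < 5 ^ l := by positivity
  -- As `l < 5 ^ l`, a word of length `l` meets at most two adjacent level-`l` supertiles. Their
  -- parent letters are consecutive in `rho.power 2 l0`, so the word occurs in level `l + 2`.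
  obtain ⟨s, hs0, hs1⟩ := exists_power_two_eq (hy ((j + m) / 5 ^ l))
  rw [power_eq_iterate_inflate] at hs0 hs1
  have hr0 := Int.emod_nonneg (j + m) hpos.ne'
  have hr1 := Int.emod_lt_of_pos (j + m) hpos
  have hqr := Int.mul_ediv_add_emod (j + m) (5 ^ l)
  set q := (j + m) / 5 ^ l
  set r := (j + m) % 5 ^ l
  have hs := s.2
  have hrt : ((r.toNat : ℕ) : ℤ) = r := by omega
  refine ⟨l0, l + 2, 5 ^ l * s + r.toNat, by omega, fun i => ⟨?_, ?_⟩⟩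
  · have hi := i.2
    zify
    rw [hrt, pow_add]
    have : (5 : ℤ) ^ l * s ≤ 5 ^ l * 23 := by gcongr; omega
    norm_num
    omega
  · push_cast
    rw [hrt, shift_apply, ← add_assoc, ← hqr, Function.iterate_add_apply]
    by_cases hi : r + (i : ℕ) < 5 ^ l
    · have := iterate_inflate_congr rho (n := l) (t := r + (i : ℕ)) hs0.symm (by omega) hi
      simp only [Nat.cast_ofNat, ← add_assoc] at this
      exact this
    · have := iterate_inflate_congr rho (n := l) (t := r + (i : ℕ) - 5 ^ l) hs1.symm (by omega)
        (by have := i.2; push_cast; omega)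
      have e : ∀ u : ℤ, (5 : ℤ) ^ l * (u + 1) + (r + (i : ℕ) - 5 ^ l) =
        5 ^ l * u + r + (i : ℕ) := fun u => by ring
      simp only [Nat.cast_ofNat, Nat.cast_add, Nat.cast_one, e] at this
      exact this

/-! ### The reflection symmetry -/

/-- The mirror image of `x`, relabelled by `tau`. -/
def mirror (x : ℤ → Letter) : ℤ → Letter := fun i => tau (x (-i))

theorem tau_tau (a : Letter) : tau (tau a) = a := by revert a; decide

theorem mirror_mirror (x : ℤ → Letter) : mirror (mirror x) = x := by
  ext i; simp [mirror, tau_tau]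

theorem IsAdjChain.mirror {x : ℤ → Letter} (h : IsAdjChain x) : IsAdjChain (mirror x) := by
  intro i
  have key : ∀ a b, Adj a b = true → Adj (tau b) (tau a) = true := by decide
  have := key _ _ (h (-(i + 1)))
  rwa [show -(i + 1) + 1 = -i by ring] at this

/-- The offset 2 puts the reflection axis on column 1. Columns 3 and 4 of a block land in the block
of the reflected right neighbour, whence the need for legal pairs. -/
theorem mirror_shift_inflate {y : ℤ → Letter} (hy : IsAdjChain y) (d : ℤ) :
    mirror (shift d (rho.inflate y)) = shift (2 - d) (rho.inflate (mirror y)) := by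
  ext i
  obtain ⟨q, c, hc⟩ := exists_eq_five_mul_add (d + -i)
  rw [mirror, shift_apply, shift_apply, hc, rho_inflate]
  have h0 : mirror y (-q) = tau (y q) := by simp [mirror]
  have h1 : mirror y (-q - 1) = tau (y (q + 1)) := by
    rw [mirror, show -(-q - 1) = q + 1 by ring]
  have e : ∀ (q' : ℤ) (c' : Fin 5), 2 - d + i = 5 * q' + (c' : ℕ) →
      rho.inflate (mirror y) (2 - d + i) = rho (mirror y q') c' := by
    intro q' c' h; rw [h, rho_inflate]
  have hadj := hy q
  revert hadj h0 h1
  generalize y q = a, y (q + 1) = b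
  intro h0 h1 hadj
  fin_cases c
  · rw [e (-q) 2 (by simp at hc ⊢; omega), h0]; clear h0 h1 hadj; revert a; decide
  · rw [e (-q) 1 (by simp at hc ⊢; omega), h0]; clear h0 h1 hadj; revert a; decide
  · rw [e (-q) 0 (by simp at hc ⊢; omega), h0]; clear h0 h1 hadj; revert a; decide
  · rw [e (-q - 1) 4 (by simp at hc ⊢; omega), h1]; clear h0 h1; revert a b; decide
  · rw [e (-q - 1) 3 (by simp at hc ⊢; omega), h1]; clear h0 h1; revert a b; decide

theorem mirror_eq_shift_inflate (x : rho.Hull) :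
    mirror x.1 = shift (2 - digit x.1 : ℤ) (rho.inflate (mirror (hullDesubstitute x).1)) := by
  conv_lhs => rw [← shift_inflate_desubstitute x.2]
  exact mirror_shift_inflate (isAdjChain_of_mem (hullDesubstitute x).2) _

theorem mirror_mem (x : rho.Hull) : mirror x.1 ∈ rho.subshift.carrier := by
  refine mem_subshift_of_forall_exists fun n => ?_
  induction n generalizing x with
  | zero => exact ⟨0, mirror x.1, (isAdjChain_of_mem x.2).mirror, by ext; simp⟩
  | succ n ih =>
    obtain ⟨j, y, hy, h⟩ := ih (hullDesubstitute x)
    refine ⟨5 * j + (2 - digit x.1), y, hy, ?_⟩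
    rw [mirror_eq_shift_inflate, h, inflate_shift, shift_shift, Function.iterate_succ_apply']
    rfl

/-- The reflection `(tau, mirror)` of the hull of `rho`. -/
def hullMirror : rho.Hull ≃ₜ rho.Hull :=
  have hc : Continuous fun x : rho.Hull => (⟨mirror x.1, mirror_mem x⟩ : rho.Hull) := by
    refine Continuous.subtype_mk (continuous_pi fun i => ?_) _
    exact (continuous_of_discreteTopology (f := tau)).comp
      ((continuous_apply (-i)).comp continuous_subtype_val)
  { toFun := fun x => ⟨mirror x.1, mirror_mem x⟩
    invFun := fun x => ⟨mirror x.1, mirror_mem x⟩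
    left_inv := fun x => Subtype.ext (mirror_mirror x.1)
    right_inv := fun x => Subtype.ext (mirror_mirror x.1)
    continuous_toFun := hc
    continuous_invFun := hc }

theorem hullMirror_apply (x : rho.Hull) (i : ℤ) : (hullMirror x).1 i = tau (x.1 (-i)) := rfl

theorem isExtendedSymmetry_hullMirror : rho.IsExtendedSymmetry hullMirror (-1) := by
  intro n x
  ext i
  rw [hullMirror_apply, hullShift_apply, hullShift_apply, hullMirror_apply]
  rw [show n + -i = -(((-1 : ℤˣ) : ℤ) * n + i) by push_cast; ring]

theorem isRadiusZero_hullMirror : rho.IsRadiusZero hullMirror tau (-1) := by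
  intro x n
  rw [hullMirror_apply]
  simp

theorem hullMirror_eq (x : rho.Hull) : hullMirror x =
    rho.hullShift (2 - digit x.1) (rho.hullInflate (hullMirror (hullDesubstitute x))) :=
  Subtype.ext (mirror_eq_shift_inflate x)

/-- With `s` the sum of the two odometer values, `s = (2 - d) + d + 5 * s'`, so `2 * s + 1 = 5 * (2
* s' + 1)`; iterate. -/
theorem two_mul_odometer_hullMirror (x : rho.Hull) :
    2 * (odometer (hullMirror x) + odometer x) + 1 = 0 := by
  apply PadicInt.eq_of_forall_pow_dvd_sub
  intro n
  rw [sub_zero]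
  induction n generalizing x with
  | zero => simp
  | succ n ih =>
    have h : 2 * (odometer (hullMirror x) + odometer x) + 1 =
        5 * (2 * (odometer (hullMirror (hullDesubstitute x)) + odometer (hullDesubstitute x)) + 1) := by
      rw [hullMirror_eq, odometer_hullShift, odometer_hullInflate, odometer_eq x]
      push_cast
      ring
    rw [h, pow_succ']
    exact mul_dvd_mul_left _ (ih _)

/-! ### Explicit points of the hull and surjectivity -/

/-- The fixed point of `x ↦ σ (ρ (x))` with the letter `a` at the origin. -/
def fixedSeq (a : Letter) (i : ℤ) : Letter :=
  if i = 0 then a else rho (fixedSeq a ((i + 1) / 5)) (Int.divModEquiv 5 (i + 1)).2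
termination_by i.natAbs
decreasing_by omega

theorem fixedSeq_zero (a : Letter) : fixedSeq a 0 = a := by rw [fixedSeq]; simp

theorem shift_inflate_fixedSeq (a : Letter) : shift 1 (rho.inflate (fixedSeq a)) = fixedSeq a := by
  ext i
  rw [shift_apply, add_comm]
  by_cases hi : i = 0
  · subst hi
    have := rho_inflate_one (fixedSeq a) 0
    simpa using this
  · conv_rhs => rw [fixedSeq]
    rw [if_neg hi]
    rfl

theorem isAdjChain_fixedSeq (a : Letter) : IsAdjChain (fixedSeq a) := by
  intro i
  induction h : i.natAbs + (i + 1).natAbs using Nat.strong_induction_on generalizing i with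
  | _ n ih =>
    rw [← shift_inflate_fixedSeq a, shift_apply, shift_apply]
    obtain ⟨q, c, hc⟩ := exists_eq_five_mul_add (1 + i)
    rw [← add_assoc, hc]
    -- Only a pair straddling a boundary needs the induction, and its parent pair lies closer to the
    -- origin.
    refine adj_inflate c fun h4 => ih _ ?_ q rfl
    subst h4
    simp at hc
    omega

theorem fixedSeq_mem (a : Letter) : fixedSeq a ∈ rho.subshift.carrier := by
  refine mem_subshift_of_forall_exists fun n => ?_
  induction n with
  | zero => exact ⟨0, fixedSeq a, isAdjChain_fixedSeq a, by ext; simp⟩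
  | succ n ih =>
    obtain ⟨j, y, hy, h⟩ := ih
    refine ⟨5 * j + 1, y, hy, ?_⟩
    conv_lhs => rw [← shift_inflate_fixedSeq a, h]
    rw [inflate_shift, shift_shift, Function.iterate_succ_apply']
    rfl

/-- The point `fixedSeq a` of the hull. -/
def fixedPoint (a : Letter) : rho.Hull := ⟨fixedSeq a, fixedSeq_mem a⟩

/-- The image is compact and contains a translate of the dense subgroup of integers. -/
theorem surjective_odometer : Function.Surjective odometer := by
  have hclosed : IsClosed (Set.range odometer) :=
    (isCompact_range continuous_odometer).isClosed
  have hdense : DenseRange odometer := by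
    have h1 : DenseRange fun m : ℤ => odometer (fixedPoint l0) + (m : ℤ_[5]) :=
      ((Homeomorph.addLeft (odometer (fixedPoint l0))).surjective.denseRange).comp
        (PadicInt.denseRange_intCast (p := 5)) (Homeomorph.addLeft _).continuous
    refine h1.mono ?_
    rintro _ ⟨m, rfl⟩
    exact ⟨rho.hullShift m (fixedPoint l0), odometer_hullShift _ _⟩
  rw [← Set.range_eq_univ, ← hclosed.closure_eq, hdense.closure_range]

/-! ### The κ-value -/

/-- Negation as an automorphism of the topological group `ℤ_[5]`. -/
noncomputable def padicNeg : ℤ_[5] ≃ₜ+ ℤ_[5] :=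
  { AddEquiv.neg ℤ_[5] with
    continuous_toFun := continuous_neg
    continuous_invFun := continuous_neg }

theorem isKappaValue_hullMirror_iff (κ : ℤ_[5]) :
    IsKappaValue odometer hullMirror κ ↔ 2 * κ + 1 = 0 := by
  constructor
  · rintro ⟨ζ, h⟩
    -- Over 0 the automorphism `ζ` drops out, so κ is determined whatever `ζ` is.
    obtain ⟨x, hx⟩ := surjective_odometer 0
    have h1 := two_mul_odometer_hullMirror x
    have h2 := h x
    rw [hx, map_zero, add_zero] at h2
    rwa [hx, add_zero, h2] at h1
  · intro hκ
    refine ⟨padicNeg, fun x => ?_⟩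
    have h1 := two_mul_odometer_hullMirror x
    have h2 : (2 : ℤ_[5]) * (odometer (hullMirror x) - (κ - odometer x)) = 0 := by
      linear_combination h1 - hκ
    have h3 := (mul_eq_zero.1 h2).resolve_left two_ne_zero
    change odometer (hullMirror x) = κ + -odometer x
    linear_combination h3

theorem exists_kappaValue_hullMirror : ∃ κ : ℤ_[5],
    (∀ κ' : ℤ_[5], IsKappaValue odometer hullMirror κ' ↔ κ' = κ) ∧ κ ≠ 0 ∧
      ∀ m : ℤ, κ ≠ (m : ℤ_[5]) := by
  set κ := odometer (hullMirror (fixedPoint l0)) + odometer (fixedPoint l0) with hκ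
  have h : 2 * κ + 1 = 0 := two_mul_odometer_hullMirror _
  have hm : ∀ m : ℤ, κ ≠ (m : ℤ_[5]) := by
    intro m hm
    rw [hm] at h
    have : 2 * m + 1 = 0 := by exact_mod_cast h
    omega
  refine ⟨κ, fun κ' => ?_, by simpa using hm 0, hm⟩
  rw [isKappaValue_hullMirror_iff]
  constructor
  · intro h'
    have h2 : (2 : ℤ_[5]) * (κ' - κ) = 0 := by linear_combination h' - h
    exact sub_eq_zero.1 ((mul_eq_zero.1 h2).resolve_left two_ne_zero)
  · rintro rfl
    exact h

/-! ### Supertile shuffling, primitivity and strong injectivity -/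

theorem rho_power_succ (n : ℕ) (a : Letter) (i : Fin (5 ^ (n + 1))) :
    rho.power (n + 1) a i = rho (rho.power n a (Fin.cast (pow_succ 5 n) i).divNat)
      (Fin.cast (pow_succ 5 n) i).modNat := rfl

theorem not_isSupertileShuffling_hullMirror : ¬ rho.IsSupertileShuffling hullMirror := by
  rintro ⟨τ, A, hA, hτ, N, hN⟩
  rcases Int.units_eq_one_or A with rfl | rfl
  -- Linear parts 1 and -1 together would give a point of period 2.
  · have h1 := hA 1 (fixedPoint l0)
    rw [isExtendedSymmetry_hullMirror] at h1
    refine rho_isAperiodic (hullMirror (fixedPoint l0)) 2 two_ne_zero ?_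
    have h2 := congrArg (rho.hullShift 1) h1
    rw [hullShift_hullShift, hullShift_hullShift] at h2
    simpa [hullShift_zero] using h2.symm
  · have key : ∀ a, τ a = tau a := by
      intro a
      have h1 := hτ (fixedPoint a) 0
      rw [hullMirror_apply] at h1
      simpa [fixedPoint, fixedSeq_zero] using h1.symm
    have hpos : 0 < 5 ^ (N + 1) := by positivity
    have h := hN (N + 1) (by omega) l0 ⟨0, hpos⟩
    rw [key, key, rho_power_succ, rho_power_succ] at h
    have e1 : (Fin.cast (pow_succ 5 N) ⟨0, hpos⟩).modNat = 0 := by ext; simp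
    have e2 : (Fin.cast (pow_succ 5 N) (blockAct (-1)⁻¹ ⟨0, hpos⟩)).modNat = 4 := by
      ext
      have : blockAct (-1)⁻¹ (⟨0, hpos⟩ : Fin (5 ^ (N + 1))) = Fin.rev ⟨0, hpos⟩ := by
        rw [blockAct, if_neg (by decide)]
      rw [this]
      simp [Fin.val_rev, pow_succ]
      omega
    -- The first letter of one supertile would be `tau` of the last letter of another; both are odd,
    -- but `tau` exchanges odd and even letters.
    rw [e1, e2] at h
    generalize rho.power N _ _ = a at h
    generalize rho.power N _ _ = b at h
    revert a b
    decide

theorem rho_isPrimitive : rho.IsPrimitive := by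
  refine ⟨2, by norm_num, fun a b => ?_⟩
  revert a b
  decide

theorem eq_of_rho_one_eq {a b : Letter} (h : rho a 1 = rho b 1) : a = b := by
  revert a b
  decide

theorem rho_power_isStronglyInjective {n : ℕ} (hn : 1 ≤ n) :
    (rho.power n).IsStronglyInjective := by
  obtain ⟨n, rfl⟩ : ∃ m, n = m + 1 := ⟨n - 1, by omega⟩
  have h5 : 5 ≤ 5 ^ (n + 1) := Nat.le_self_pow (by omega) 5
  constructor
  · rintro ⟨x, y, hx, hy, h0, h⟩
    have hmod : ∀ k, k < 5 → k < 5 ^ (n + 1) := fun k hk => by omega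
    have key : ∀ (z : ℕ → Letter), (rho.power (n + 1)).inflateLeft z = z → ∀ k (hk : k < 5),
        z k = rho (rho.power n (z 0) (Fin.cast (pow_succ 5 n) (Fin.rev ⟨0, hmod 0 (by omega)⟩)).divNat)
          (Fin.rev ⟨k, hk⟩) := by
      intro z hz k hk
      conv_lhs => rw [← hz]
      have e : Nat.divModEquiv (5 ^ (n + 1)) k = (0, ⟨k, hmod k hk⟩) := by
        apply (Nat.divModEquiv (5 ^ (n + 1))).symm.injective
        simpa using Nat.div_add_mod' _ _
      rw [inflateLeft, e, rho_power_succ]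
      have e1 : (Fin.cast (pow_succ 5 n) (Fin.rev ⟨k, hmod k hk⟩)).divNat =
          (Fin.cast (pow_succ 5 n) (Fin.rev ⟨0, hmod 0 (by omega)⟩)).divNat := by
        ext
        simp only [Fin.coe_divNat, Fin.val_cast, Fin.val_rev]
        rw [pow_succ]
        omega
      have e2 : (Fin.cast (pow_succ 5 n) (Fin.rev ⟨k, hmod k hk⟩)).modNat = Fin.rev ⟨k, hk⟩ := by
        ext
        simp only [Fin.coe_modNat, Fin.val_cast, Fin.val_rev]
        rw [pow_succ]
        omega
      rw [e1, e2]
    -- Counted from the right, entry 3 is column 1 of the last block and determines that block,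
    -- including its entry 0.
    have h3 := h 3 (by norm_num)
    have hb := eq_of_rho_one_eq (((key x hx 3 (by norm_num)).symm.trans h3).trans
      (key y hy 3 (by norm_num)))
    apply h0
    rw [key x hx 0 (by norm_num), key y hy 0 (by norm_num), hb]
  · rintro ⟨x, y, hx, hy, h0, h⟩
    have hmod : ∀ k, k < 5 → k < 5 ^ (n + 1) := fun k hk => by omega
    have key : ∀ (z : ℕ → Letter), (rho.power (n + 1)).inflateRight z = z → ∀ k (hk : k < 5),
        z k = rho (rho.power n (z 0) ⟨0, by positivity⟩) ⟨k, hk⟩ := by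
      intro z hz k hk
      conv_lhs => rw [← hz]
      have e : Nat.divModEquiv (5 ^ (n + 1)) k = (0, ⟨k, hmod k hk⟩) := by
        apply (Nat.divModEquiv (5 ^ (n + 1))).symm.injective
        simpa using Nat.div_add_mod' _ _
      rw [inflateRight, e, rho_power_succ]
      have e1 : (Fin.cast (pow_succ 5 n) ⟨k, hmod k hk⟩).divNat = ⟨0, by positivity⟩ := by
        ext
        simp only [Fin.coe_divNat, Fin.val_cast]
        omega
      have e2 : (Fin.cast (pow_succ 5 n) ⟨k, hmod k hk⟩).modNat = ⟨k, hk⟩ := by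
        ext
        simp only [Fin.coe_modNat, Fin.val_cast]
        omega
      rw [e1, e2]
    have h1 := h 1 (by norm_num)
    have hb := eq_of_rho_one_eq (((key x hx 1 (by norm_num)).symm.trans h1).trans
      (key y hy 1 (by norm_num)))
    apply h0
    rw [key x hx 0 (by norm_num), key y hy 0 (by norm_num), hb]

/-! ### Equicontinuous factors and maximality -/

theorem fixedSeq_five_mul_add (a : Letter) (q : ℤ) (c : Fin 5) :
    fixedSeq a (5 * q + (c : ℕ) - 1) = rho (fixedSeq a q) c := by
  conv_lhs => rw [← shift_inflate_fixedSeq a]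
  rw [shift_apply, add_sub_cancel, rho_inflate]

theorem isOdd_iff_of_digit (x : rho.Hull) :
    digit x.1 = 3 ↔ (x.1 0).isOdd = false ∧ (x.1 1).isOdd = true := by
  have hd := digit_lt x.1
  have h := hasPhase_inflate (desubstitute x.1) (digit x.1)
  rw [shift_inflate_desubstitute x.2] at h
  have h0 := h 0 trivial
  have h1 := h 1 trivial
  generalize digit x.1 = d at hd h0 h1
  interval_cases d <;> norm_num at h0 h1 <;> simp [h0, h1]

section RegionallyProximal

variable {R : rho.Hull → rho.Hull → Prop}

/-- A shift-invariant equivalence relation which holds between points that agree at `0` and `1`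
holds between all the points `fixedPoint a`. -/
theorem rel_fixedPoint (hR : Equivalence R)
    (hs : ∀ m u v, R u v → R (rho.hullShift m u) (rho.hullShift m v))
    (hl : ∀ u v : rho.Hull, u.1 0 = v.1 0 → u.1 1 = v.1 1 → R u v) (a b : Letter) :
    R (fixedPoint a) (fixedPoint b) := by
  have hm : ∀ (m : ℤ) (c d : Letter), fixedSeq c m = fixedSeq d m →
      fixedSeq c (m + 1) = fixedSeq d (m + 1) → R (fixedPoint c) (fixedPoint d) := by
    intro m c d h0 h1
    have := hs (-m) _ _ (hl (rho.hullShift m (fixedPoint c)) (rho.hullShift m (fixedPoint d))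
      (by simpa [hullShift_apply, fixedPoint] using h0)
      (by simpa [hullShift_apply, fixedPoint] using h1))
    simpa [hullShift_hullShift, hullShift_zero] using this
  have v1 : ∀ c, fixedSeq c 1 = rho c 2 := fun c => by
    simpa [fixedSeq_zero] using fixedSeq_five_mul_add c 0 2
  have v2 : ∀ c, fixedSeq c 2 = rho c 3 := fun c => by
    simpa [fixedSeq_zero] using fixedSeq_five_mul_add c 0 3
  have u1 : ∀ c, fixedSeq c (-1) = rho c 0 := fun c => by
    simpa [fixedSeq_zero] using fixedSeq_five_mul_add c 0 0
  have u2 : ∀ c, fixedSeq c (-2) = rho (rho c 0) 4 := fun c => by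
    simpa [u1] using fixedSeq_five_mul_add c (-1) 4
  have u3 : ∀ c, fixedSeq c (-3) = rho (rho c 0) 3 := fun c => by
    simpa [u1] using fixedSeq_five_mul_add c (-1) 3
  have hright : ∀ c d, rho c 2 = rho d 2 → rho c 3 = rho d 3 → R (fixedPoint c) (fixedPoint d) :=
    fun c d h0 h1 => hm 1 c d (by rw [v1, v1, h0]) (by norm_num; rw [v2, v2, h1])
  have hleft : ∀ c d, rho c 0 = rho d 0 → R (fixedPoint c) (fixedPoint d) :=
    fun c d h => hm (-3) c d (by rw [u3, u3, h]) (by norm_num; rw [u2, u2, h])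
  have key : ∀ c, R (fixedPoint l0) (fixedPoint c) := by
    -- The chain 0, 5, 6, 3, 2, 1 alternates between images sharing columns 2 and 3 and images
    -- sharing column 0.
    have h5 := hright l0 l5 rfl rfl
    have h6 := hR.trans h5 (hleft l5 l6 rfl)
    have h3 := hR.trans h6 (hright l6 l3 rfl rfl)
    have h2 := hR.trans h3 (hleft l3 l2 rfl)
    have h1 := hR.trans h2 (hright l2 l1 rfl rfl)
    intro c
    cases c
    exacts [hR.refl _, h1, h2, h3, h5, h6]
  exact hR.trans (hR.symm (key a)) (key b)

/-- Each legal pair occurs around the origin in a shift of some `fixedPoint c` by -1, 0 or 2. The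
first two cases merge through the word 16, which occurs at both phases, so only two candidate
classes remain: digit 3 and the rest. -/
theorem rel_of_digit_eq (hR : Equivalence R)
    (hs : ∀ m u v, R u v → R (rho.hullShift m u) (rho.hullShift m v))
    (hl : ∀ u v : rho.Hull, u.1 0 = v.1 0 → u.1 1 = v.1 1 → R u v) {u v : rho.Hull}
    (h : digit u.1 = digit v.1) : R u v := by
  have hfix := rel_fixedPoint hR hs hl
  have val : ∀ (c : Letter) (k : Fin 5), fixedSeq c ((k : ℕ) - 1) = rho c k := fun c k => by
    simpa [fixedSeq_zero] using fixedSeq_five_mul_add c 0 k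
  have hneg : ∀ c, R (rho.hullShift (-1) (fixedPoint c)) (fixedPoint l0) := by
    intro c
    refine hR.trans (hs (-1) _ _ (hfix c l6)) (hR.trans (hl _ _ ?_ ?_) (hfix l1 l0))
    · have := val l6 0
      simp only [hullShift_apply, fixedPoint, fixedSeq_zero, add_zero]
      exact this
    · have := val l1 2
      simp only [hullShift_apply, fixedPoint, fixedSeq_zero, neg_add_cancel]
      exact this.symm
  have words : ∀ a b, Adj a b = true → (∃ c, a = rho c 0 ∧ b = c ∧ ¬ (a.isOdd = false ∧ b.isOdd = true)) ∨
      (∃ c, a = c ∧ b = rho c 2 ∧ ¬ (a.isOdd = false ∧ b.isOdd = true)) ∨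
      (∃ c, a = rho c 3 ∧ b = rho c 4 ∧ (a.isOdd = false ∧ b.isOdd = true)) := by decide
  have key : ∀ w : rho.Hull, (digit w.1 ≠ 3 ∧ R w (fixedPoint l0)) ∨
      (digit w.1 = 3 ∧ R w (rho.hullShift 2 (fixedPoint l0))) := by
    intro w
    rw [Ne, isOdd_iff_of_digit]
    rcases words _ _ (isAdjChain_of_mem w.2 0) with ⟨c, h0, h1, hw⟩ | ⟨c, h0, h1, hw⟩ |
      ⟨c, h0, h1, hw⟩
    · refine .inl ⟨hw, hR.trans (hl _ _ ?_ ?_) (hneg c)⟩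
      · have := val c 0
        simpa [hullShift_apply, fixedPoint, h0] using this.symm
      · simpa [hullShift_apply, fixedPoint, fixedSeq_zero] using h1
    · refine .inl ⟨hw, hR.trans (hl _ _ ?_ ?_) (hfix c l0)⟩
      · simpa [fixedPoint, fixedSeq_zero] using h0
      · have := val c 2
        simp only [zero_add] at h1
        simpa [fixedPoint, h1] using this.symm
    · refine .inr ⟨hw, hR.trans (hl _ _ ?_ ?_) (hs 2 _ _ (hfix c l0))⟩
      · have := val c 3
        norm_num at this
        simpa [hullShift_apply, fixedPoint, h0] using this.symm
      · have := val c 4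
        norm_num at this
        simp only [zero_add] at h1
        norm_num [hullShift_apply, fixedPoint, h1]
        exact this.symm
  rcases key u with ⟨hu, hu'⟩ | ⟨hu, hu'⟩ <;> rcases key v with ⟨hv, hv'⟩ | ⟨hv, hv'⟩
  · exact hR.trans hu' (hR.symm hv')
  · exact absurd (h.trans hv) hu
  · exact absurd (h.symm.trans hu) hv
  · exact hR.trans hu' (hR.symm hv')

end RegionallyProximal

/-- A continuous function on the hull depends, up to an entourage, on a finite window only. -/
theorem exists_window_of_continuous {α : Type*} [TopologicalSpace α] [DiscreteTopology α]
    [Finite α] {L : ℕ} (θ : Substitution α L) {Y : Type*} [UniformSpace Y] {f : θ.Hull → Y}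
    (hf : Continuous f) {V : Set (Y × Y)} (hV : V ∈ 𝓤 Y) :
    ∃ N : ℕ, ∀ u v : θ.Hull, (∀ i : ℤ, -N ≤ i → i ≤ N → u.1 i = v.1 i) → (f u, f v) ∈ V := by
  let K : ℕ → Set (θ.Hull × θ.Hull) := fun N =>
    {p | ∀ i : ℤ, -N ≤ i → i ≤ N → p.1.1 i = p.2.1 i}
  have hK : ∀ N, IsClosed (K N) := by
    intro N
    simp only [K, Set.ofPred_forall]
    refine isClosed_iInter fun i => isClosed_iInter fun _ => isClosed_iInter fun _ => ?_
    exact isClosed_eq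
      ((continuous_apply i).comp (continuous_subtype_val.comp continuous_fst))
      ((continuous_apply i).comp (continuous_subtype_val.comp continuous_snd))
  have hanti : Antitone K := fun m n hmn p hp i h1 h2 => hp i (by omega) (by omega)
  -- The compact sets `K N` decrease to the diagonal, so one of them lies in the preimage of `V`.
  obtain ⟨N, hN⟩ := exists_subset_nhds_of_isCompact' (V := K) (hanti.directed_ge)
    (fun N => (hK N).isCompact) hK (U := (Prod.map f f) ⁻¹' V) (by
      rintro ⟨u, v⟩ huv
      obtain rfl : u = v := by
        ext i
        have := Set.mem_iInter.1 huv i.natAbs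
        exact this i (by omega) (by omega)
      have : Tendsto (Prod.map f f) (𝓝 (u, u)) (𝓤 Y) :=
        ((hf.prodMap hf).tendsto (u, u)).trans (nhds_le_uniformity (f u))
      exact this hV)
  exact ⟨N, fun u v h => hN (show (u, v) ∈ K N from h)⟩

theorem digit_eq_of_odometer_eq {u v : rho.Hull} (h : odometer u = odometer v) :
    digit u.1 = digit v.1 := by
  have key : ∀ w : rho.Hull, (5 : ℤ_[5]) ^ 1 ∣ odometer w - (digit w.1 : ℤ) := fun w => by
    have := pow_dvd_odometer_sub 1 (digit w.1) (hullDesubstitute w)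
    rwa [Function.iterate_one, hullShift_hullInflate_desubstitute] at this
  have h1 := dvd_sub (key v) (key u)
  rw [h, sub_sub_sub_cancel_left] at h1
  have h2 : ((5 : ℕ) : ℤ) ^ 1 ∣ (digit u.1 : ℤ) - digit v.1 := by
    rw [← PadicInt.pow_p_dvd_int_iff]
    push_cast at h1 ⊢
    exact h1
  have := digit_lt u.1
  have := digit_lt v.1
  omega

section Equicontinuous

variable {Y : Type*} [UniformSpace Y] {S : Y ≃ₜ Y} {f : rho.Hull → Y}

theorem map_hullShift (hfS : ∀ x, f (rho.hullShift 1 x) = S (f x)) (m : ℤ) (x : rho.Hull) :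
    f (rho.hullShift m x) = (S ^ m : Y ≃ₜ Y) (f x) := by
  induction m generalizing x with
  | zero => rw [hullShift_zero, zpow_zero]; rfl
  | succ m ih =>
    have : rho.hullShift (m + 1) x = rho.hullShift m (rho.hullShift 1 x) := by
      rw [hullShift_hullShift, add_comm]
    rw [this, ih, hfS, zpow_add_one]
    rfl
  | pred m ih =>
    have hx : f x = S (f (rho.hullShift (-1) x)) := by
      rw [← hfS, hullShift_hullShift, neg_add_cancel, hullShift_zero]
    have : rho.hullShift (-m - 1) x = rho.hullShift (-m) (rho.hullShift (-1) x) := by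
      rw [hullShift_hullShift, sub_eq_add_neg, add_comm]
    rw [this, ih, zpow_sub_one, hx]
    change _ = (S ^ (-m : ℤ) : Y ≃ₜ Y) (S.symm (S _))
    rw [S.symm_apply_apply]

/-- The bounds on `j` keep it at distance at least `5 ^ n / 2` from both ends of the two supertiles
over 0 and 1, so a fixed window around `j` eventually fits inside them. -/
theorem eventually_mem_of_agree (hf : Continuous f) {V : Set (Y × Y)} (hV : V ∈ 𝓤 Y) :
    ∀ᶠ n : ℕ in atTop, ∀ j : ℤ, 5 ^ n ≤ 2 * j → 2 * j ≤ 3 * 5 ^ n → ∀ u v : rho.Hull,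
      u.1 0 = v.1 0 → u.1 1 = v.1 1 → (f (rho.hullShift j (rho.hullInflate^[n] u)),
        f (rho.hullShift j (rho.hullInflate^[n] v))) ∈ V := by
  obtain ⟨N, hN⟩ := exists_window_of_continuous rho hf hV
  filter_upwards [eventually_ge_atTop (2 * N)] with n hn j hj1 hj2 u v h0 h1
  have hn5 : (n : ℤ) < 5 ^ n := by exact_mod_cast Nat.lt_pow_self (by norm_num)
  refine hN _ _ fun i hi1 hi2 => ?_
  rw [hullShift_apply, hullShift_apply, coe_hullInflate_iterate, coe_hullInflate_iterate]
  by_cases hi : j + i < 5 ^ n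
  · have := iterate_inflate_congr rho (n := n) (t := j + i) h0 (by omega) hi
    simpa using this
  · have := iterate_inflate_congr rho (n := n) (t := j + i - 5 ^ n) h1 (by omega)
      (by push_cast; omega)
    simpa using this

theorem eventually_mem_of_digit_eq (hf : Continuous f)
    (hS : UniformEquicontinuous fun n : ℤ => ((S ^ n : Y ≃ₜ Y) : Y → Y))
    (hfS : ∀ x, f (rho.hullShift 1 x) = S (f x)) {u v : rho.Hull} (h : digit u.1 = digit v.1)
    {V : Set (Y × Y)} (hV : V ∈ 𝓤 Y) :
    ∀ᶠ n : ℕ in atTop, ∀ j : ℤ, 5 ^ n ≤ 2 * j → 2 * j ≤ 3 * 5 ^ n →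
      (f (rho.hullShift j (rho.hullInflate^[n] u)),
        f (rho.hullShift j (rho.hullInflate^[n] v))) ∈ V := by
  let R : rho.Hull → rho.Hull → Prop := fun u v => ∀ V ∈ 𝓤 Y, ∀ᶠ n : ℕ in atTop,
    ∀ j : ℤ, 5 ^ n ≤ 2 * j → 2 * j ≤ 3 * 5 ^ n →
      (f (rho.hullShift j (rho.hullInflate^[n] u)),
        f (rho.hullShift j (rho.hullInflate^[n] v))) ∈ V
  have hR : Equivalence R := by
    refine ⟨fun u V hV => ?_, fun {u v} huv V hV => ?_, fun {u v w} huv hvw V hV => ?_⟩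
    · exact .of_forall fun n j _ _ => refl_mem_uniformity hV
    · filter_upwards [huv _ (symm_le_uniformity hV)] with n hn j h1 h2 using hn j h1 h2
    · obtain ⟨W, hW, hWV⟩ := comp_mem_uniformity_sets hV
      filter_upwards [huv W hW, hvw W hW] with n hn hn' j h1 h2
      exact hWV ⟨_, hn j h1 h2, hn' j h1 h2⟩
  refine rel_of_digit_eq hR (fun m u v huv V hV => ?_) (fun u v h0 h1 V hV => ?_) h V hV
  -- Shifting by `m` becomes the power `5 ^ n * m` of `S`, which varies with `n`; uniform
  -- equicontinuity controls all powers at once.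
  · filter_upwards [huv _ (hS V hV)] with n hn j h1 h2
    have key : ∀ w : rho.Hull, f (rho.hullShift j (rho.hullInflate^[n] (rho.hullShift m w))) =
        (S ^ ((5 : ℤ) ^ n * m) : Y ≃ₜ Y) (f (rho.hullShift j (rho.hullInflate^[n] w))) := by
      intro w
      rw [← map_hullShift hfS, hullInflate_iterate_hullShift, hullShift_hullShift,
        hullShift_hullShift, add_comm]
      rfl
    rw [key, key]
    exact hn j h1 h2 _
  · filter_upwards [eventually_mem_of_agree hf hV] with n hn j hj1 hj2
    exact hn j hj1 hj2 u v h0 h1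

/-- Equicontinuous factors do not separate the points of a fibre of the odometer. -/
theorem eq_of_odometer_eq [T2Space Y] (hf : Continuous f)
    (hS : UniformEquicontinuous fun n : ℤ => ((S ^ n : Y ≃ₜ Y) : Y → Y))
    (hfS : ∀ x, f (rho.hullShift 1 x) = S (f x)) {x x' : rho.Hull}
    (h : odometer x = odometer x') : f x = f x' := by
  refine eq_of_uniformity fun {V} hV => ?_
  obtain ⟨W, hW, hWV⟩ := comp3_mem_uniformity hV
  -- The parents `y`, `y'` found below depend on `n`, so one `n` must serve all pairs. Only finitely
  -- many pairs of two-letter words occur, and one representative for each suffices.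
  have hev : ∀ᶠ n : ℕ in atTop, ∀ w : (Letter × Letter) × (Letter × Letter), ∀ j : ℤ,
      5 ^ n ≤ 2 * j → 2 * j ≤ 3 * 5 ^ n → ∀ u v : rho.Hull, (u.1 0, u.1 1) = w.1 →
      (v.1 0, v.1 1) = w.2 → digit u.1 = digit v.1 →
      (f (rho.hullShift j (rho.hullInflate^[n] u)),
        f (rho.hullShift j (rho.hullInflate^[n] v))) ∈ V := by
    refine eventually_all.2 fun w => ?_
    by_cases hw : ∃ u v : rho.Hull, (u.1 0, u.1 1) = w.1 ∧ (v.1 0, v.1 1) = w.2 ∧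
        digit u.1 = digit v.1
    · obtain ⟨u₀, v₀, hu₀, hv₀, hd₀⟩ := hw
      filter_upwards [eventually_mem_of_agree hf hW,
        eventually_mem_of_digit_eq hf hS hfS hd₀ hW] with n h1 h2 j hj1 hj2 u v hu hv _
      have hu' := Prod.ext_iff.1 (hu.trans hu₀.symm)
      have hv' := Prod.ext_iff.1 (hv₀.trans hv.symm)
      exact hWV ⟨_, h1 j hj1 hj2 u u₀ hu'.1 hu'.2, _, h2 j hj1 hj2,
        h1 j hj1 hj2 v₀ v hv'.1 hv'.2⟩
    · exact .of_forall fun n j _ _ u v hu hv hd => absurd ⟨u, v, hu, hv, hd⟩ hw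
  obtain ⟨n, hn⟩ := hev.exists
  obtain ⟨y, j, hj, hx⟩ := exists_hullShift_hullInflate_iterate n x
  obtain ⟨y', j', hj', hx'⟩ := exists_hullShift_hullInflate_iterate n x'
  obtain rfl : j = j' := by
    have h1 := dvd_sub (pow_dvd_odometer_sub n j' y') (pow_dvd_odometer_sub n j y)
    rw [← hx, ← hx', h, sub_sub_sub_cancel_left] at h1
    have h2 : ((5 : ℕ) : ℤ) ^ n ∣ (j : ℤ) - j' := by
      rw [← PadicInt.pow_p_dvd_int_iff]
      push_cast at h1 ⊢
      exact h1
    have h3 : (5 ^ n : ℕ) ∣ ((j : ℤ) - j').natAbs := Int.natCast_dvd.1 (by exact_mod_cast h2)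
    have := Nat.eq_zero_of_dvd_of_lt h3 (by omega)
    omega
  have hy : odometer y = odometer y' := by
    rw [hx, hx', odometer_hullShift, odometer_hullShift, odometer_hullInflate_iterate,
      odometer_hullInflate_iterate] at h
    exact mul_left_cancel₀ (pow_ne_zero n (by norm_num)) (add_right_cancel h)
  zify at hj
  by_cases hj2 : (5 : ℤ) ^ n ≤ 2 * j
  · rw [hx, hx']
    exact hn (_, _) j hj2 (by omega) y y' rfl rfl (digit_eq_of_odometer_eq hy)
  -- An origin in the left half of its supertile is brought into the admissible range by shifting
  -- the parent by -1.
  · have e : ∀ w : rho.Hull, rho.hullShift j (rho.hullInflate^[n] w) =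
        rho.hullShift (j + 5 ^ n) (rho.hullInflate^[n] (rho.hullShift (-1) w)) := by
      intro w
      rw [hullInflate_iterate_hullShift, hullShift_hullShift]
      congr 1
      push_cast
      ring
    rw [hx, hx', e, e]
    refine hn (_, _) _ (by omega) (by omega) _ _ rfl rfl (digit_eq_of_odometer_eq ?_)
    rw [odometer_hullShift, odometer_hullShift, hy]

end Equicontinuous

theorem isMaximalEquicontinuousFactor_odometer :
    IsMaximalEquicontinuousFactor (rho.hullShift 1) (1 : ℤ_[5]) odometer where
  continuous := continuous_odometer
  surjective := surjective_odometer
  equivariant x := by simpa using odometer_hullShift 1 x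
  maximal Y _ _ _ S hS f hf _ hfS := by
    have hq : IsQuotientMap odometer :=
      continuous_odometer.isClosedMap.isQuotientMap continuous_odometer surjective_odometer
    have hfac : f = (f ∘ Function.surjInv surjective_odometer) ∘ odometer := by
      ext x
      exact eq_of_odometer_eq hf hS hfS (Function.surjInv_eq surjective_odometer _).symm
    refine ⟨f ∘ Function.surjInv surjective_odometer, ?_, fun z => ?_, hfac⟩
    · rw [hq.continuous_iff, ← hfac]
      exact hf
    · obtain ⟨x, rfl⟩ := surjective_odometer z
      have h1 := congrFun hfac x
      have h2 := congrFun hfac (rho.hullShift 1 x)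
      rw [Function.comp_apply, odometer_hullShift, Int.cast_one, hfS] at h2
      rw [← h2, h1]
      rfl

theorem mainTheorem8 :
    rho.IsPrimitive ∧ rho.IsAperiodic ∧
    (∀ n : ℕ, 1 ≤ n → (rho.power n).IsStronglyInjective) ∧
    ∃ Φ : rho.Hull ≃ₜ rho.Hull,
      rho.IsExtendedSymmetry Φ (-1) ∧
      rho.IsRadiusZero Φ tau (-1) ∧
      ¬ rho.IsSupertileShuffling Φ ∧
      ∃ π : rho.Hull → ℤ_[5],
        (∀ π' : rho.Hull → ℤ_[5], rho.IsTilingFactor π' ↔ π' = π) ∧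
        IsMaximalEquicontinuousFactor (rho.hullShift 1) (1 : ℤ_[5]) π ∧
        ∃ κ : ℤ_[5],
          (∀ κ' : ℤ_[5], IsKappaValue π Φ κ' ↔ κ' = κ) ∧
          κ ≠ 0 ∧
          ∀ m : ℤ, κ ≠ (m : ℤ_[5]) :=
  ⟨rho_isPrimitive, rho_isAperiodic, fun _ hn => rho_power_isStronglyInjective hn, hullMirror,
    isExtendedSymmetry_hullMirror, isRadiusZero_hullMirror, not_isSupertileShuffling_hullMirror,
    odometer, isTilingFactor_iff, isMaximalEquicontinuousFactor_odometer,
    exists_kappaValue_hullMirror⟩
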